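/- Let $\mathbb F=\mathbb R$ or $\mathbb F=\mathbb C$, let $m\ge 2$ be an integer, and let $0\le l\le m$ be an integer. Let $\mathcal U$ be the compact group of orthogonal (if $\mathbb F=\mathbb R$) or unitary (if $\mathbb F=\mathbb C$) $m\times m$ matrices and let $\mu$ be its normalized Haar measure, $\mu(\mathcal U)=1$. Define the $2$-coherence tensor $$K_{2,l,m}=\int_{\mathcal U}(UPU^*)\otimes(UPU^*)\,d\mu(U),$$ where $P$ is any rank-$l$ orthogonal projection matrix on $\mathbb F^m$ (the value does not depend on the choice of $P$), $U^*$ is the adjoint of $U$ (the transpose in the real case), and $\otimes$ is the Kronecker product. Set $d_{\mathbb R}(m)=\frac{(m+2)(m-1)}{2}$ and $d_{\mathbb C}(m)=m^2-1$. Then $$K_{2,l,m}=\Bigl(l-\frac{l(l-1)}{m-1}\Bigr)K_{2,1,m}+\frac{l(l-1)}{m(m-1)}\,I_m\otimes I_m .$$ Moreover, for every orthonormal basis $\{e_j\}_{j=1}^m$ of $\mathbb F^m$, with $E_{j,j'}=e_je_{j'}^*$, $$K_{2,1,m}=a\sum_{j=1}^m E_{j,j}\otimes E_{j,j}+\sum_{\substack{j,j'=1\\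 j\ne j'}}^m\Bigl(b\,\bigl(E_{j,j'}\otimes E_{j',j}+E_{j,j}\otimes E_{j',j'}\bigr)+c\,E_{j,j'}\otimes E_{j,j'}\Bigr),$$ where $a=\dfrac{d_{\mathbb F}(m)+(m-1)^2}{m^2\,d_{\mathbb F}(m)}$, and $b=c=a/3$ if $\mathbb F=\mathbb R$, while $b=a/2$, $c=0$ if $\mathbb F=\mathbb C$. -/

import Mathlib

open MeasureTheory Matrix
open scoped Kronecker

namespace FusionFrame

/-- The group of unitary `m × m` matrices over `𝕜`, where `𝕜` is `ℝ` or `ℂ`. For `𝕜 = ℝ` the star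
operation of `ℝ` is trivial, so this is the orthogonal group. -/
abbrev U (𝕜 : Type*) [RCLike 𝕜] (m : ℕ) : Type _ := Matrix.unitaryGroup (Fin m) 𝕜

instance instMeasurableSpaceU (𝕜 : Type*) [RCLike 𝕜] (m : ℕ) : MeasurableSpace (U 𝕜 m) :=
  borel (U 𝕜 m)

instance instBorelSpaceU (𝕜 : Type*) [RCLike 𝕜] (m : ℕ) : BorelSpace (U 𝕜 m) := ⟨rfl⟩

instance instCompactSpaceU (𝕜 : Type*) [RCLike 𝕜] (m : ℕ) : CompactSpace (U 𝕜 m) := by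
  have hc : IsCompact (Set.pi Set.univ fun _ : Fin m => Set.pi Set.univ fun _ : Fin m =>
      Metric.closedBall (0 : 𝕜) 1) :=
    isCompact_univ_pi fun _ => isCompact_univ_pi fun _ => isCompact_closedBall _ _
  have hcl : IsClosed {A : Matrix (Fin m) (Fin m) 𝕜 | A ∈ Matrix.unitaryGroup (Fin m) 𝕜} := by
    simp only [Matrix.mem_unitaryGroup_iff]
    exact isClosed_eq (continuous_id.matrix_mul continuous_id.matrix_conjTranspose)
      continuous_const
  refine isCompact_iff_compactSpace.mp (hc.of_isClosed_subset hcl ?_)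
  intro A hA
  refine Set.mem_univ_pi.mpr fun i => Set.mem_univ_pi.mpr fun j => ?_
  rw [mem_closedBall_zero_iff]
  exact entry_norm_bound_of_unitary hA i j

/-- The normalized Haar measure on the compact group of unitary (orthogonal) matrices: the Haar
measure that gives the whole group mass `1`. -/
noncomputable def haarU (𝕜 : Type*) [RCLike 𝕜] (m : ℕ) : Measure (U 𝕜 m) :=
  Measure.haarMeasure ⊤

instance instIsHaarMeasureHaarU (𝕜 : Type*) [RCLike 𝕜] (m : ℕ) : (haarU 𝕜 m).IsHaarMeasure := by
  unfold haarU
  infer_instance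

instance instIsProbabilityMeasureHaarU (𝕜 : Type*) [RCLike 𝕜] (m : ℕ) :
    IsProbabilityMeasure (haarU 𝕜 m) :=
  ⟨by simpa [haarU] using Measure.haarMeasure_self (G := U 𝕜 m) (K₀ := ⊤)⟩

/-- The `2`-coherence tensor `∫ (V P V*) ⊗ (V P V*) dμ(V)` of a matrix `P`, where `μ` is the
normalized Haar measure. The matrix-valued integral is taken entry by entry. -/
noncomputable def coherence₂ {𝕜 : Type*} [RCLike 𝕜] {m : ℕ} (P : Matrix (Fin m) (Fin m) 𝕜) :
    Matrix (Fin m × Fin m) (Fin m × Fin m) 𝕜 :=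
  Matrix.of fun p q =>
    ∫ V : U 𝕜 m, (((V.1 * P * V.1ᴴ) ⊗ₖ (V.1 * P * V.1ᴴ)) p q) ∂(haarU 𝕜 m)

/-- `P` is the matrix of an orthogonal projection onto an `l`-dimensional subspace of `𝕜^m`. -/
def IsProjOfRank {𝕜 : Type*} [RCLike 𝕜] {m : ℕ} (l : ℕ) (P : Matrix (Fin m) (Fin m) 𝕜) : Prop :=
  IsStarProjection P ∧ P.rank = l

/-- The matrix unit `E_{j,k} = e_j ⊗ e_k*` of an orthonormal basis `e` of `𝕜^m`. -/
noncomputable def matUnit {𝕜 : Type*} [RCLike 𝕜] {m : ℕ}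
    (e : OrthonormalBasis (Fin m) 𝕜 (EuclideanSpace 𝕜 (Fin m))) (j k : Fin m) :
    Matrix (Fin m) (Fin m) 𝕜 :=
  Matrix.vecMulVec (e j).ofLp (star (e k).ofLp)

/-- The tensor
`a ∑_j E_{j,j} ⊗ E_{j,j} + ∑_{j ≠ k} (b (E_{j,k} ⊗ E_{k,j} + E_{j,j} ⊗ E_{k,k}) + c E_{j,k} ⊗ E_{j,k})`
with respect to an orthonormal basis `e`. -/
noncomputable def basisTensor {𝕜 : Type*} [RCLike 𝕜] {m : ℕ}
    (e : OrthonormalBasis (Fin m) 𝕜 (EuclideanSpace 𝕜 (Fin m))) (a b c : 𝕜) :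
    Matrix (Fin m × Fin m) (Fin m × Fin m) 𝕜 :=
  a • ∑ j, matUnit e j j ⊗ₖ matUnit e j j +
    ∑ j, ∑ k ∈ Finset.univ.filter (fun k => j ≠ k),
      (b • (matUnit e j k ⊗ₖ matUnit e k j + matUnit e j j ⊗ₖ matUnit e k k) +
        c • (matUnit e j k ⊗ₖ matUnit e j k))

/-- `d_ℝ(m)`, the dimension of the space of traceless symmetric real `m × m` matrices. -/
noncomputable def dReal (m : ℕ) : ℝ := ((m : ℝ) + 2) * ((m : ℝ) - 1) / 2

/-- `d_ℂ(m)`, the real dimension of the space of traceless Hermitian complex `m × m` matrices. -/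
noncomputable def dComplex (m : ℕ) : ℝ := (m : ℝ) ^ 2 - 1

/-- The coefficient `a = (d + (m - 1)²) / (m² d)`. -/
noncomputable def coeffA (m : ℕ) (d : ℝ) : ℝ := (d + ((m : ℝ) - 1) ^ 2) / ((m : ℝ) ^ 2 * d)

end FusionFrame

/-!
The coherence tensor of `P` depends only on the rank of `P`, and both identities express its
invariance under left and right translations of the Haar measure.

*Reduction to rank one.* By right invariance `P` may be replaced by a coordinate projection onto a
set `S` of coordinates, and its tensor becomes the sum over `a, b ∈ S` of the fourth moments
`∫ V_{ia} V̄_{ja} V_{kb} V̄_{lb} dμ(V)` of the columns `a` and `b` (`colMoment`). Permuting columns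
shows that there are only two such tensors: one, say `T`, for `a = b`, which is the tensor of rank
one, and one, say `G`, for `a ≠ b`. Hence rank `l` gives `l T + l (l - 1) G`, and summing over all
columns gives `I ⊗ I = m T + m (m - 1) G`; eliminating `G` is `coherence₂_eq_rank_one`.

*Rank one.* A column `x` of `V` is uniformly distributed on the unit sphere, and the tensor
consists of the moments of `x_i x̄_j x_k x̄_l`. Sign changes of coordinates annihilate all moments
except those whose indices coincide in pairs (`colMoment_eq_zero`). For `i ≠ j` the moment of
`(x_i x̄_j)²` is that of `|x_i|² |x_j|²` over `ℝ`, and vanishes over `ℂ` by multiplying `x_i` with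
the imaginary unit. A single reflection that mixes two coordinates determines the ratio of the
moments of `|x_i|⁴` and `|x_i|² |x_j|²` (`colMoment_diag_eq`), and `∑ |x_i|² = 1` fixes the scale
(`colMoment_eq`). The result is a combination of three pairings of Kronecker deltas; completeness
of an orthonormal basis identifies it with `basisTensor` (`basisTensor_apply`).
-/

namespace FusionFrame

variable {𝕜 : Type*} [RCLike 𝕜] {m : ℕ}

/-! ### Haar measure and moments of columns -/

/-- Compact groups are unimodular: a right translate of the normalized Haar measure is again a Haar
probability measure, hence the same measure. -/
instance instIsMulRightInvariantHaarU : (haarU 𝕜 m).IsMulRightInvariant := by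
  refine ⟨fun g => ?_⟩
  have : IsProbabilityMeasure ((haarU 𝕜 m).map (· * g)) :=
    Measure.isProbabilityMeasure_map (measurable_mul_const g).aemeasurable
  exact Measure.isHaarMeasure_eq_of_isProbabilityMeasure _ _

@[fun_prop]
lemma continuous_entry (i a : Fin m) : Continuous fun V : U 𝕜 m => V.1 i a :=
  continuous_subtype_val.matrix_elem i a

lemma integrable_of_continuous {f : U 𝕜 m → 𝕜} (hf : Continuous f) : Integrable f (haarU 𝕜 m) :=
  hf.integrable_of_hasCompactSupport (HasCompactSupport.of_compactSpace f)

/-- The mixed fourth moment `∫ V_{ia} V̄_{ja} V_{kb} V̄_{lb} dμ(V)` of the entries of the columns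
`a` and `b` of a Haar-distributed unitary matrix. -/
noncomputable def colMoment (a b i j k l : Fin m) : 𝕜 :=
  ∫ V : U 𝕜 m, V.1 i a * star (V.1 j a) * (V.1 k b * star (V.1 l b)) ∂haarU 𝕜 m

lemma colMoment_left (W : U 𝕜 m) (a b i j k l : Fin m) :
    colMoment (𝕜 := 𝕜) a b i j k l = ∫ V : U 𝕜 m, (W.1 * V.1) i a * star ((W.1 * V.1) j a) *
      ((W.1 * V.1) k b * star ((W.1 * V.1) l b)) ∂haarU 𝕜 m :=
  (integral_mul_left_eq_self (μ := haarU 𝕜 m)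
    (fun V : U 𝕜 m => V.1 i a * star (V.1 j a) * (V.1 k b * star (V.1 l b))) W).symm

lemma colMoment_right (W : U 𝕜 m) (a b i j k l : Fin m) :
    colMoment (𝕜 := 𝕜) a b i j k l = ∫ V : U 𝕜 m, (V.1 * W.1) i a * star ((V.1 * W.1) j a) *
      ((V.1 * W.1) k b * star ((V.1 * W.1) l b)) ∂haarU 𝕜 m :=
  (integral_mul_right_eq_self (μ := haarU 𝕜 m)
    (fun V : U 𝕜 m => V.1 i a * star (V.1 j a) * (V.1 k b * star (V.1 l b))) W).symm

/-! ### Symmetry under permutations of rows and columns -/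

/-- The permutation matrix of `σ`, as a unitary matrix. -/
noncomputable def permU (σ : Equiv.Perm (Fin m)) : U 𝕜 m :=
  ⟨σ.permMatrix 𝕜, by
    rw [Matrix.mem_unitaryGroup_iff, star_eq_conjTranspose, conjTranspose_permMatrix,
      ← permMatrix_mul, inv_mul_cancel, permMatrix_one]⟩

lemma permU_mul_apply (σ : Equiv.Perm (Fin m)) (V : Matrix (Fin m) (Fin m) 𝕜) (i a : Fin m) :
    ((permU σ : U 𝕜 m).1 * V) i a = V (σ i) a := by
  simp [permU, Equiv.Perm.permMatrix, PEquiv.toMatrix_toPEquiv_mul]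

lemma mul_permU_apply (σ : Equiv.Perm (Fin m)) (V : Matrix (Fin m) (Fin m) 𝕜) (i a : Fin m) :
    (V * (permU σ⁻¹ : U 𝕜 m).1) i a = V i (σ a) := by
  simp [permU, Equiv.Perm.permMatrix, PEquiv.mul_toMatrix_toPEquiv]
  rfl

lemma colMoment_perm_rows (σ : Equiv.Perm (Fin m)) (a b i j k l : Fin m) :
    colMoment (𝕜 := 𝕜) a b (σ i) (σ j) (σ k) (σ l) = colMoment a b i j k l := by
  rw [colMoment_left (permU σ) a b i j k l]
  simp only [permU_mul_apply, colMoment]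

lemma colMoment_perm_cols (σ : Equiv.Perm (Fin m)) (a b i j k l : Fin m) :
    colMoment (𝕜 := 𝕜) (σ a) (σ b) i j k l = colMoment a b i j k l := by
  rw [colMoment_right (permU σ⁻¹) a b i j k l]
  simp only [mul_permU_apply, colMoment]

/-- The symmetric group acts transitively on ordered pairs of distinct points. -/
lemma exists_perm_pair {α : Type*} [DecidableEq α] {a b c d : α} (hab : a ≠ b) (hcd : c ≠ d) :
    ∃ σ : Equiv.Perm α, σ a = c ∧ σ b = d := by
  refine ⟨Equiv.swap (Equiv.swap a c b) d * Equiv.swap a c, ?_, by simp⟩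
  have h : c ≠ Equiv.swap a c b := fun h => hab <| by
    rw [eq_comm, Equiv.swap_apply_eq_iff, Equiv.swap_apply_right] at h
    exact h.symm
  rw [Equiv.Perm.mul_apply, Equiv.swap_apply_left, Equiv.swap_apply_of_ne_of_ne h hcd]

lemma colMoment_self_eq (a a' i j k l : Fin m) :
    colMoment (𝕜 := 𝕜) a a i j k l = colMoment a' a' i j k l := by
  simpa using colMoment_perm_cols (𝕜 := 𝕜) (Equiv.swap a' a) a' a' i j k l

lemma colMoment_pair_eq {a b c d : Fin m} (hab : a ≠ b) (hcd : c ≠ d) (i j k l : Fin m) :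
    colMoment (𝕜 := 𝕜) a b i j k l = colMoment c d i j k l := by
  obtain ⟨σ, rfl, rfl⟩ := exists_perm_pair hcd hab
  exact colMoment_perm_cols σ c d i j k l

lemma sum_entry_mul_star (V : U 𝕜 m) (i j : Fin m) :
    ∑ a, V.1 i a * star (V.1 j a) = if i = j then 1 else 0 := by
  have h := congrFun (congrFun ((Matrix.mem_unitaryGroup_iff).1 V.2) i) j
  rwa [star_eq_conjTranspose, Matrix.mul_apply, Matrix.one_apply] at h

lemma sum_star_mul_entry (V : U 𝕜 m) (a b : Fin m) :
    ∑ i, star (V.1 i a) * V.1 i b = if a = b then 1 else 0 := by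
  have h := congrFun (congrFun ((Matrix.mem_unitaryGroup_iff').1 V.2) a) b
  rwa [star_eq_conjTranspose, Matrix.mul_apply, Matrix.one_apply] at h

/-- Resolution of the identity over all pairs of columns. -/
lemma sum_sum_colMoment (i j k l : Fin m) :
    ∑ a, ∑ b, colMoment (𝕜 := 𝕜) a b i j k l =
      (if i = j then 1 else 0) * (if k = l then 1 else 0) := by
  have h (a : Fin m) : ∑ b, colMoment (𝕜 := 𝕜) a b i j k l =
      ∫ V : U 𝕜 m, ∑ b, V.1 i a * star (V.1 j a) * (V.1 k b * star (V.1 l b)) ∂haarU 𝕜 m :=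
    (integral_finsetSum Finset.univ fun b _ => integrable_of_continuous (by fun_prop)).symm
  simp_rw [h]
  rw [← integral_finsetSum Finset.univ fun a _ => integrable_of_continuous (by fun_prop)]
  simp_rw [← Finset.mul_sum, ← Finset.sum_mul, sum_entry_mul_star]
  simp

/-! ### Reduction to projections of rank one -/

lemma coherence₂_conj (W : U 𝕜 m) (P : Matrix (Fin m) (Fin m) 𝕜) :
    coherence₂ (W.1 * P * W.1ᴴ) = coherence₂ P := by
  ext p q
  simp only [coherence₂, Matrix.of_apply]
  rw [← integral_mul_right_eq_self (μ := haarU 𝕜 m)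
    (fun V : U 𝕜 m => ((V.1 * P * V.1ᴴ) ⊗ₖ (V.1 * P * V.1ᴴ)) p q) W]
  simp [Matrix.conjTranspose_mul, Matrix.mul_assoc]

lemma coherence₂_diagonal (S : Finset (Fin m)) (i j k l : Fin m) :
    coherence₂ (diagonal fun a => if a ∈ S then (1 : 𝕜) else 0) (i, k) (j, l) =
      ∑ a ∈ S, ∑ b ∈ S, colMoment a b i j k l := by
  have h (V : U 𝕜 m) (i j : Fin m) :
      (V.1 * (diagonal fun a => if a ∈ S then (1 : 𝕜) else 0) * V.1ᴴ) i j =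
        ∑ a ∈ S, V.1 i a * star (V.1 j a) := by
    simp [Matrix.mul_apply, Matrix.diagonal_apply, Finset.sum_ite_mem]
  simp only [coherence₂, Matrix.of_apply, kroneckerMap_apply, h, colMoment,
    Finset.sum_mul_sum]
  rw [integral_finsetSum S fun a _ => integrable_of_continuous (by fun_prop)]
  exact Finset.sum_congr rfl fun a _ =>
    integral_finsetSum S fun b _ => integrable_of_continuous (by fun_prop)

/-- An orthogonal projection is unitarily diagonalizable with eigenvalues `0` and `1`. -/
lemma IsProjOfRank.exists_diagonal {r : ℕ} {P : Matrix (Fin m) (Fin m) 𝕜}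
    (hP : IsProjOfRank r P) :
    ∃ (W : U 𝕜 m) (S : Finset (Fin m)), S.card = r ∧
      P = W.1 * (diagonal fun a => if a ∈ S then (1 : 𝕜) else 0) * W.1ᴴ := by
  obtain ⟨hp, hr⟩ := hP
  have hH : P.IsHermitian := hp.isSelfAdjoint
  have hspec : P = hH.eigenvectorUnitary.1 *
      diagonal (RCLike.ofReal ∘ hH.eigenvalues) * hH.eigenvectorUnitary.1ᴴ := by
    simpa [Unitary.conjStarAlgAut_apply, star_eq_conjTranspose] using hH.spectral_theorem
  have hev (a : Fin m) : hH.eigenvalues a = 0 ∨ hH.eigenvalues a = 1 := by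
    have := hp.isIdempotentElem.spectrum_subset ℝ (hH.eigenvalues_mem_spectrum_real a)
    simpa using this
  refine ⟨hH.eigenvectorUnitary, Finset.univ.filter fun a => hH.eigenvalues a ≠ 0, ?_, ?_⟩
  · rw [← hr, hH.rank_eq_card_non_zero_eigs, Fintype.card_subtype]
  · have hdiag : (fun a => if a ∈ Finset.univ.filter (fun a => hH.eigenvalues a ≠ 0)
        then (1 : 𝕜) else 0) = RCLike.ofReal ∘ hH.eigenvalues := by
      ext a
      rcases hev a with h | h <;> simp [h]
    rw [hdiag]
    exact hspec

/-- A rank one projection has the moments of a single column as its coherence tensor. -/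
lemma coherence₂_rank_one {Q : Matrix (Fin m) (Fin m) 𝕜} (hQ : IsProjOfRank 1 Q)
    (a i j k l : Fin m) : coherence₂ Q (i, k) (j, l) = colMoment a a i j k l := by
  obtain ⟨W, S, hS, rfl⟩ := hQ.exists_diagonal
  obtain ⟨c, rfl⟩ := Finset.card_eq_one.1 hS
  rw [coherence₂_conj, coherence₂_diagonal]
  simpa using colMoment_self_eq c a i j k l

lemma sum_sum_eq_card {ι R : Type*} [DecidableEq ι] [CommRing R] (S : Finset ι) {f : ι → ι → R}
    {x y : R}
    (hx : ∀ a, f a a = x) (hy : ∀ a b, a ≠ b → f a b = y) :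
    ∑ a ∈ S, ∑ b ∈ S, f a b = S.card * x + S.card * (S.card - 1) * y := by
  have h (a : ι) (ha : a ∈ S) : ∑ b ∈ S, f a b = x + (S.card - 1) * y := by
    rw [← Finset.add_sum_erase S _ ha, hx,
      Finset.sum_congr rfl fun b hb => hy a b (Finset.ne_of_mem_erase hb).symm,
      Finset.sum_const, Finset.card_erase_of_mem ha, nsmul_eq_mul,
      Nat.cast_sub (Finset.card_pos.2 ⟨a, ha⟩), Nat.cast_one]
  rw [Finset.sum_congr rfl h, Finset.sum_const, nsmul_eq_mul]
  ring

/-- The tensor of rank `r` in terms of the tensor of rank one and the identity. -/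
lemma coherence₂_eq_rank_one (hm : 2 ≤ m) {r : ℕ} {P Q : Matrix (Fin m) (Fin m) 𝕜}
    (hP : IsProjOfRank r P) (hQ : IsProjOfRank 1 Q) :
    coherence₂ P = ((r : 𝕜) - r * (r - 1) / (m - 1)) • coherence₂ Q +
      ((r : 𝕜) * (r - 1) / (m * (m - 1))) •
        ((1 : Matrix (Fin m) (Fin m) 𝕜) ⊗ₖ (1 : Matrix (Fin m) (Fin m) 𝕜)) := by
  obtain ⟨W, S, rfl, rfl⟩ := hP.exists_diagonal
  have h01 : (⟨0, by lia⟩ : Fin m) ≠ ⟨1, by lia⟩ := by simp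
  have hm0 : (m : 𝕜) ≠ 0 := by exact_mod_cast (by lia : m ≠ 0)
  have hm1 : (m : 𝕜) - 1 ≠ 0 := sub_ne_zero.2 (by exact_mod_cast (by lia : m ≠ 1))
  ext ⟨i, k⟩ ⟨j, l⟩
  -- `key S` computes the tensor of `P`, and `key Finset.univ` resolves the identity; they involve
  -- the same two column moments.
  have key (T : Finset (Fin m)) := sum_sum_eq_card T
    (f := fun a b => colMoment (𝕜 := 𝕜) a b i j k l)
    (fun a => colMoment_self_eq a ⟨0, by lia⟩ i j k l)
    (fun a b hab => colMoment_pair_eq hab h01 i j k l)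
  have hall := (key Finset.univ).symm.trans (sum_sum_colMoment i j k l)
  rw [Finset.card_univ, Fintype.card_fin] at hall
  rw [coherence₂_conj, coherence₂_diagonal, key S]
  simp only [Matrix.add_apply, Matrix.smul_apply, smul_eq_mul, kroneckerMap_apply,
    Matrix.one_apply, coherence₂_rank_one hQ ⟨0, by lia⟩]
  rw [← hall]
  field_simp
  ring

/-! ### The moments of a single column -/

/-- A diagonal matrix with unimodular entries, as a unitary matrix. -/
noncomputable def phaseU (d : Fin m → 𝕜) (hd : ∀ i, d i * star (d i) = 1) : U 𝕜 m :=
  ⟨diagonal d, by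
    rw [Matrix.mem_unitaryGroup_iff, star_eq_conjTranspose, diagonal_conjTranspose,
      diagonal_mul_diagonal, ← diagonal_one]
    exact congrArg diagonal (funext hd)⟩

lemma colMoment_phase (d : Fin m → 𝕜) (hd : ∀ i, d i * star (d i) = 1) (a b i j k l : Fin m) :
    colMoment (𝕜 := 𝕜) a b i j k l =
      d i * star (d j) * (d k * star (d l)) * colMoment a b i j k l := by
  conv_lhs => rw [colMoment_left (phaseU d hd) a b i j k l]
  simp only [colMoment, ← integral_const_mul, phaseU, diagonal_mul, star_mul']
  congr 1
  ext V
  ring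

/-- A moment on which some unimodular change of phases acts nontrivially is zero. -/
lemma colMoment_eq_zero_of_phase (d : Fin m → 𝕜) (hd : ∀ i, d i * star (d i) = 1)
    {a b i j k l : Fin m} (h : d i * star (d j) * (d k * star (d l)) ≠ 1) :
    colMoment (𝕜 := 𝕜) a b i j k l = 0 := by
  by_contra h0
  exact h (mul_right_cancel₀ h0 ((colMoment_phase d hd a b i j k l).symm.trans (one_mul _).symm))

/-- Changing the sign of one coordinate shows that a moment vanishes unless its row indices
coincide in pairs, because otherwise some row index occurs an odd number of times. -/
lemma colMoment_eq_zero {a b i j k l : Fin m} (h1 : i = j → k ≠ l) (h2 : i = l → k ≠ j)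
    (h3 : i = k → j ≠ l) : colMoment (𝕜 := 𝕜) a b i j k l = 0 := by
  by_contra h0
  have hsign (p : Fin m) := not_imp_comm.1 (colMoment_eq_zero_of_phase (𝕜 := 𝕜)
    (a := a) (b := b) (i := i) (j := j) (k := k) (l := l) (fun q => if q = p then -1 else 1)
    (fun q => by split_ifs <;> simp)) h0
  -- Characteristic zero is what `simp_all` needs to refute a sign change.
  have hne : (-1 : 𝕜) ≠ 1 := by norm_num
  have hi := hsign i
  have hk := hsign k
  have hl := hsign l
  by_cases hij : i = j <;> by_cases hik : i = k <;> by_cases hil : i = l <;>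
    by_cases hjk : j = k <;> by_cases hjl : j = l <;> by_cases hkl : k = l <;>
    simp_all [eq_comm]

/-- Within a single column the two conjugated indices may be interchanged. -/
lemma colMoment_swap_star (a i j k l : Fin m) :
    colMoment (𝕜 := 𝕜) a a i j k l = colMoment a a i l k j := by
  simp only [colMoment]
  congr 1
  ext V
  ring

lemma colMoment_swap (a i j k l : Fin m) :
    colMoment (𝕜 := 𝕜) a a i j k l = colMoment a a k l i j := by
  simp only [colMoment]
  congr 1
  ext V
  ring

/-- Left translation invariance, with the entries of the product expanded. -/
lemma colMoment_expand (W : U 𝕜 m) (a b i j k l : Fin m) :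
    colMoment (𝕜 := 𝕜) a b i j k l =
      ∑ p, W.1 i p * ∑ q, star (W.1 j q) * ∑ r, W.1 k r * ∑ s, star (W.1 l s) *
        colMoment a b p q r s := by
  have hs (p q r : Fin m) := integral_finsetSum (μ := haarU 𝕜 m) Finset.univ fun s _ =>
    integrable_of_continuous (𝕜 := 𝕜) (f := fun V : U 𝕜 m =>
      star (W.1 l s) * (V.1 p a * star (V.1 q a) * (V.1 r b * star (V.1 s b)))) (by fun_prop)
  have hr (p q : Fin m) := integral_finsetSum (μ := haarU 𝕜 m) Finset.univ fun r _ =>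
    integrable_of_continuous (𝕜 := 𝕜) (f := fun V : U 𝕜 m => W.1 k r * ∑ s,
      star (W.1 l s) * (V.1 p a * star (V.1 q a) * (V.1 r b * star (V.1 s b)))) (by fun_prop)
  have hq (p : Fin m) := integral_finsetSum (μ := haarU 𝕜 m) Finset.univ fun q _ =>
    integrable_of_continuous (𝕜 := 𝕜) (f := fun V : U 𝕜 m => star (W.1 j q) * ∑ r, W.1 k r * ∑ s,
      star (W.1 l s) * (V.1 p a * star (V.1 q a) * (V.1 r b * star (V.1 s b)))) (by fun_prop)
  have hp := integral_finsetSum (μ := haarU 𝕜 m) Finset.univ fun p _ =>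
    integrable_of_continuous (𝕜 := 𝕜) (f := fun V : U 𝕜 m =>
      W.1 i p * ∑ q, star (W.1 j q) * ∑ r, W.1 k r * ∑ s,
      star (W.1 l s) * (V.1 p a * star (V.1 q a) * (V.1 r b * star (V.1 s b)))) (by fun_prop)
  rw [colMoment_left W]
  simp only [colMoment, ← integral_const_mul, ← hs, ← hr, ← hq, ← hp]
  congr 1
  ext V
  simp only [Matrix.mul_apply, star_sum, star_mul', Finset.sum_mul, mul_assoc]
  simp only [Finset.mul_sum]
  refine Finset.sum_congr rfl fun p _ => Finset.sum_congr rfl fun q _ =>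
    Finset.sum_congr rfl fun r _ => Finset.sum_congr rfl fun s _ => ?_
  ring

/-- A unitary matrix whose row `i` is `(3 / 5) e_i - (4 / 5) e_j`: the reflection in the hyperplane
orthogonal to `w = e_i + 2 e_j`. -/
lemma exists_unitary_row {i j : Fin m} (hij : i ≠ j) :
    ∃ W : U 𝕜 m, W.1 i = Pi.single i (3 / 5) - Pi.single j (4 / 5) := by
  let w : Fin m → 𝕜 := Pi.single i 1 + Pi.single j 2
  have hw : star w = w := by simp [w]
  have hww : w ⬝ᵥ w = 5 := by
    simp [w, hij, hij.symm]
    norm_num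
  refine ⟨⟨1 - (2 / 5 : 𝕜) • vecMulVec w w, ?_⟩, ?_⟩
  · have hstar : star (1 - (2 / 5 : 𝕜) • vecMulVec w w) = 1 - (2 / 5 : 𝕜) • vecMulVec w w := by
      rw [star_eq_conjTranspose, conjTranspose_sub, conjTranspose_smul, conjTranspose_vecMulVec,
        hw, conjTranspose_one]
      simp
    rw [Matrix.mem_unitaryGroup_iff, hstar]
    simp only [mul_sub, sub_mul, Matrix.mul_smul, Matrix.smul_mul, vecMulVec_mul_vecMulVec, hww,
      Matrix.mul_one, Matrix.one_mul, vecMulVec_smul]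
    module
  · ext q
    by_cases hqi : q = i
    · subst hqi
      simp [w, vecMulVec_apply, hij]
      norm_num
    · by_cases hqj : q = j
      · subst hqj
        simp [w, vecMulVec_apply, hij, hij.symm]
        norm_num
      · simp [w, vecMulVec_apply, hij, hqi, hqj, Ne.symm hqi]

/-- Invariance under a reflection mixing the coordinates `i` and `j` relates the fourth moment of
one coordinate to the mixed moment of two coordinates. -/
lemma colMoment_diag_eq (κ : 𝕜) (a : Fin m) {i j : Fin m} (hij : i ≠ j)
    (hκ : ∀ i j, i ≠ j → colMoment (𝕜 := 𝕜) a a i j i j = κ * colMoment a a i i j j) :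
    colMoment (𝕜 := 𝕜) a a i i i i = (2 + κ) * colMoment a a i i j j := by
  obtain ⟨W, hW⟩ := exists_unitary_row (𝕜 := 𝕜) hij
  have hsum (f : Fin m → 𝕜) : ∑ p, W.1 i p * f p = 3 / 5 * f i - 4 / 5 * f j := by
    simp [hW, sub_mul, Finset.sum_sub_distrib, Pi.single_apply]
  have hsum' (f : Fin m → 𝕜) : ∑ p, star (W.1 i p) * f p = 3 / 5 * f i - 4 / 5 * f j := by
    have hstar (p : Fin m) : star (W.1 i p) = W.1 i p := by
      rw [hW, Pi.sub_apply, Pi.single_apply, Pi.single_apply]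
      split_ifs <;> simp
    simp_rw [hstar, hsum]
  have hexp := colMoment_expand W a a i i i i
  have hperm : colMoment (𝕜 := 𝕜) a a j j j j = colMoment a a i i i i := by
    simpa using colMoment_perm_rows (𝕜 := 𝕜) (Equiv.swap i j) a a i i i i
  have hz1 : ∀ {p q : Fin m}, p ≠ q → colMoment (𝕜 := 𝕜) a a p p p q = 0 := fun h =>
    colMoment_eq_zero (by simp [h]) (by simp [h]) (by simp [h])
  have hz2 : ∀ {p q : Fin m}, p ≠ q → colMoment (𝕜 := 𝕜) a a q p p p = 0 := fun h =>
    colMoment_eq_zero (by simp [h.symm]) (by simp [h.symm]) (by simp [h.symm])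
  have hz3 : ∀ {p q : Fin m}, p ≠ q → colMoment (𝕜 := 𝕜) a a p q p p = 0 := fun h =>
    colMoment_eq_zero (by simp [h]) (by simp [h]) (by simp [h.symm])
  have hz4 : ∀ {p q : Fin m}, p ≠ q → colMoment (𝕜 := 𝕜) a a p p q p = 0 := fun h =>
    colMoment_eq_zero (by simp [h.symm]) (by simp [h.symm]) (by simp [h])
  -- Of the sixteen terms, `hexp` keeps `(81 + 256) / 625` times the fourth moment and
  -- `144 / 625 * (4 + 2 κ)` times the mixed moment, and `1 - 337 / 625 = 288 / 625`.
  simp only [hsum, hsum', hz1 hij, hz1 hij.symm, hz2 hij, hz2 hij.symm, hz3 hij, hz3 hij.symm,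
    hz4 hij, hz4 hij.symm, hκ i j hij, hκ j i hij.symm, colMoment_swap_star a i j j i,
    colMoment_swap_star a j i i j, colMoment_swap a j j i i, hperm] at hexp
  linear_combination (625 / 288 : 𝕜) * hexp

/-- The fourth moments of one column of a Haar-distributed matrix. The parameter `κ` records the
only difference between the fields: it is `1` over `ℝ` and `0` over `ℂ`. -/
lemma colMoment_eq (hm : 2 ≤ m) (κ : 𝕜) (hκ0 : (m : 𝕜) + 1 + κ ≠ 0) (a : Fin m)
    (hκ : ∀ i j, i ≠ j → colMoment (𝕜 := 𝕜) a a i j i j = κ * colMoment a a i i j j)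
    (i j k l : Fin m) :
    colMoment (𝕜 := 𝕜) a a i j k l = 1 / (m * (m + 1 + κ)) *
      ((if i = j ∧ k = l then 1 else 0) + (if i = l ∧ k = j then 1 else 0) +
        κ * (if i = k ∧ j = l then 1 else 0)) := by
  have hm0 : (m : 𝕜) ≠ 0 := by exact_mod_cast (by lia : m ≠ 0)
  let i₀ : Fin m := ⟨0, by lia⟩
  let i₁ : Fin m := ⟨1, by lia⟩
  have h01 : i₀ ≠ i₁ := by simp [i₀, i₁]
  have hB : ∀ i j, i ≠ j → colMoment (𝕜 := 𝕜) a a i i j j = colMoment a a i₀ i₀ i₁ i₁ := by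
    intro i j hij
    obtain ⟨σ, rfl, rfl⟩ := exists_perm_pair h01 hij
    exact colMoment_perm_rows σ a a i₀ i₀ i₁ i₁
  have hA (i : Fin m) : colMoment (𝕜 := 𝕜) a a i i i i =
      (2 + κ) * colMoment a a i₀ i₀ i₁ i₁ := by
    obtain ⟨j, hj⟩ : ∃ j, i ≠ j := by
      by_cases h : i = i₀
      · exact ⟨i₁, h ▸ h01⟩
      · exact ⟨i₀, h⟩
    rw [colMoment_diag_eq κ a hj hκ, hB i j hj]
  -- The column `a` is a unit vector.
  have hone : ∑ i, ∑ k, colMoment (𝕜 := 𝕜) a a i i k k = 1 := by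
    have h (i : Fin m) : ∑ k, colMoment (𝕜 := 𝕜) a a i i k k =
        ∫ V : U 𝕜 m, ∑ k, V.1 i a * star (V.1 i a) * (V.1 k a * star (V.1 k a)) ∂haarU 𝕜 m :=
      (integral_finsetSum Finset.univ fun k _ => integrable_of_continuous (by fun_prop)).symm
    have hcol (V : U 𝕜 m) : ∑ i, V.1 i a * star (V.1 i a) = 1 := by
      simpa [mul_comm] using sum_star_mul_entry V a a
    simp_rw [h]
    rw [← integral_finsetSum Finset.univ fun i _ => integrable_of_continuous (by fun_prop)]
    simp_rw [← Finset.mul_sum, ← Finset.sum_mul, hcol]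
    simp
  rw [sum_sum_eq_card Finset.univ (f := fun i k => colMoment (𝕜 := 𝕜) a a i i k k) hA hB,
    Finset.card_univ, Fintype.card_fin] at hone
  have hval : colMoment (𝕜 := 𝕜) a a i₀ i₀ i₁ i₁ = 1 / (m * (m + 1 + κ)) := by
    rw [eq_div_iff (mul_ne_zero hm0 hκ0)]
    linear_combination hone
  rw [hval] at hA hB
  by_cases h1 : i = j ∧ k = l
  · obtain ⟨rfl, rfl⟩ := h1
    by_cases hik : i = k
    · subst hik
      simp [hA]
      ring
    · simp [hB i k hik, hik]
  by_cases h2 : i = l ∧ k = j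
  · obtain ⟨rfl, rfl⟩ := h2
    have hik : i ≠ k := fun h => h1 ⟨h, h.symm⟩
    simp [colMoment_swap_star a i k k i, hB i k hik, hik]
  by_cases h3 : i = k ∧ j = l
  · obtain ⟨rfl, rfl⟩ := h3
    have hij : i ≠ j := fun h => h1 ⟨h, h⟩
    simp [hκ i j hij, hB i j hij, hij, mul_comm]
  · rw [colMoment_eq_zero (fun h h' => h1 ⟨h, h'⟩) (fun h h' => h2 ⟨h, h'⟩)
      (fun h h' => h3 ⟨h, h'⟩)]
    simp [h1, h2, h3]

/-! ### The basis tensor -/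

lemma sum_basis_mul_star (e : OrthonormalBasis (Fin m) 𝕜 (EuclideanSpace 𝕜 (Fin m)))
    (i j : Fin m) : ∑ p, (e p).ofLp i * star ((e p).ofLp j) = if i = j then 1 else 0 := by
  have h := e.sum_inner_mul_inner (EuclideanSpace.single i (1 : 𝕜)) (EuclideanSpace.single j 1)
  simpa [EuclideanSpace.inner_single_left, EuclideanSpace.inner_single_right,
    Pi.single_apply, eq_comm] using h

/-- When `a = 2 b + c` the diagonal terms of the basis tensor merge with the off-diagonal ones. -/
lemma basisTensor_apply (e : OrthonormalBasis (Fin m) 𝕜 (EuclideanSpace 𝕜 (Fin m)))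
    (b c : 𝕜) (i j k l : Fin m) :
    basisTensor e (2 * b + c) b c (i, k) (j, l) =
      b * ((if i = j ∧ k = l then 1 else 0) + (if i = l ∧ k = j then 1 else 0)) +
        c * ((∑ p, (e p).ofLp i * (e p).ofLp k) *
          ∑ q, star ((e q).ofLp j) * star ((e q).ofLp l)) := by
  have hterm (p q : Fin m) :
      (b • (matUnit e p q ⊗ₖ matUnit e q p + matUnit e p p ⊗ₖ matUnit e q q) +
        c • (matUnit e p q ⊗ₖ matUnit e p q)) (i, k) (j, l) =
      b * ((e p).ofLp i * star ((e p).ofLp l) * ((e q).ofLp k * star ((e q).ofLp j))) +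
      b * ((e p).ofLp i * star ((e p).ofLp j) * ((e q).ofLp k * star ((e q).ofLp l))) +
      c * ((e p).ofLp i * (e p).ofLp k * (star ((e q).ofLp j) * star ((e q).ofLp l))) := by
    simp only [matUnit, Matrix.add_apply, Matrix.smul_apply, kroneckerMap_apply, vecMulVec_apply,
      Pi.star_apply, smul_eq_mul]
    ring
  have hsplit : basisTensor e (2 * b + c) b c = ∑ p, ∑ q,
      (b • (matUnit e p q ⊗ₖ matUnit e q p + matUnit e p p ⊗ₖ matUnit e q q) +
        c • (matUnit e p q ⊗ₖ matUnit e p q)) := by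
    rw [basisTensor, Finset.smul_sum, ← Finset.sum_add_distrib]
    refine Finset.sum_congr rfl fun p _ => ?_
    rw [Finset.filter_ne, ← Finset.add_sum_erase Finset.univ _ (Finset.mem_univ p)]
    congr 1
    module
  rw [hsplit]
  simp only [Matrix.sum_apply, hterm]
  simp only [Finset.sum_add_distrib, ← Finset.mul_sum, ← Finset.sum_mul,
    sum_basis_mul_star, ite_and]
  split_ifs <;> ring

theorem coherence₂_rank_one_real (hm : 2 ≤ m) {Q : Matrix (Fin m) (Fin m) ℝ} (hQ : IsProjOfRank 1 Q)
    (e : OrthonormalBasis (Fin m) ℝ (EuclideanSpace ℝ (Fin m))) :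
    coherence₂ Q =
      basisTensor e (coeffA m (dReal m)) (coeffA m (dReal m) / 3) (coeffA m (dReal m) / 3) := by
  have hmR : (2 : ℝ) ≤ m := by exact_mod_cast hm
  have hm0 : (m : ℝ) ≠ 0 := by positivity
  have hm1 : (m : ℝ) - 1 ≠ 0 := by linarith
  have hm2 : (m : ℝ) + 2 ≠ 0 := by positivity
  have hcoeff : coeffA m (dReal m) = 3 * (1 / (m * (m + 1 + 1))) := by
    rw [coeffA, dReal]
    field_simp
    ring
  ext ⟨i, k⟩ ⟨j, l⟩
  have hsum := basisTensor_apply e (coeffA m (dReal m) / 3) (coeffA m (dReal m) / 3) i j k l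
  have h1 := sum_basis_mul_star e i k
  have h2 := sum_basis_mul_star e j l
  simp only [star_trivial] at hsum h1 h2
  rw [h1, h2, show 2 * (coeffA m (dReal m) / 3) + coeffA m (dReal m) / 3 = coeffA m (dReal m) by
    ring] at hsum
  rw [hsum, coherence₂_rank_one hQ ⟨0, by lia⟩,
    colMoment_eq hm 1 (by positivity) _ (fun i j _ => by simp [colMoment, mul_mul_mul_comm]),
    hcoeff]
  simp only [ite_and]
  split_ifs <;> ring

theorem coherence₂_rank_one_complex (hm : 2 ≤ m) {Q : Matrix (Fin m) (Fin m) ℂ}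
    (hQ : IsProjOfRank 1 Q) (e : OrthonormalBasis (Fin m) ℂ (EuclideanSpace ℂ (Fin m))) :
    coherence₂ Q =
      basisTensor e (coeffA m (dComplex m) : ℝ) (coeffA m (dComplex m) / 2 : ℝ) 0 := by
  have hmR : (2 : ℝ) ≤ m := by exact_mod_cast hm
  have hm0 : (m : ℝ) ≠ 0 := by positivity
  have hm1 : (m : ℝ) - 1 ≠ 0 := by linarith
  have hm2 : (m : ℝ) + 1 ≠ 0 := by positivity
  have hcoeff : coeffA m (dComplex m) = 2 * (1 / (m * (m + 1))) := by
    rw [coeffA, dComplex, show (m : ℝ) ^ 2 - 1 = (m - 1) * (m + 1) by ring]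
    field_simp
    ring
  ext ⟨i, k⟩ ⟨j, l⟩
  have hsum := basisTensor_apply e (coeffA m (dComplex m) / 2 : ℝ) 0 i j k l
  rw [show 2 * ((coeffA m (dComplex m) / 2 : ℝ) : ℂ) + 0 = (coeffA m (dComplex m) : ℝ) by
    push_cast; ring] at hsum
  -- Multiplying coordinate `i` by the imaginary unit multiplies this moment by `-1`.
  have hzero (a i j : Fin m) (hij : i ≠ j) : colMoment (𝕜 := ℂ) a a i j i j = 0 :=
    colMoment_eq_zero_of_phase (fun p => if p = i then Complex.I else 1)
      (fun p => by split_ifs <;> simp) (by simp [hij.symm]; norm_num)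
  rw [hsum, coherence₂_rank_one hQ ⟨0, by lia⟩,
    colMoment_eq hm 0 (by rw [add_zero]; exact_mod_cast (by lia : m + 1 ≠ 0)) _
      (fun i j hij => by rw [hzero _ _ _ hij, zero_mul]), hcoeff]
  push_cast
  simp

end FusionFrame

theorem mainTheorem8 (m : ℕ) (hm : 2 ≤ m) :
    -- the real case
    (∀ (l : ℕ) (P Q : Matrix (Fin m) (Fin m) ℝ),
      FusionFrame.IsProjOfRank l P → FusionFrame.IsProjOfRank 1 Q →
      ∀ e : OrthonormalBasis (Fin m) ℝ (EuclideanSpace ℝ (Fin m)),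
        FusionFrame.coherence₂ P =
            ((l : ℝ) - (l : ℝ) * ((l : ℝ) - 1) / ((m : ℝ) - 1)) • FusionFrame.coherence₂ Q +
              ((l : ℝ) * ((l : ℝ) - 1) / ((m : ℝ) * ((m : ℝ) - 1))) •
                ((1 : Matrix (Fin m) (Fin m) ℝ) ⊗ₖ (1 : Matrix (Fin m) (Fin m) ℝ)) ∧
          FusionFrame.coherence₂ Q =
            FusionFrame.basisTensor e
              (FusionFrame.coeffA m (FusionFrame.dReal m))
              (FusionFrame.coeffA m (FusionFrame.dReal m) / 3)
              (FusionFrame.coeffA m (FusionFrame.dReal m) / 3)) ∧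
    -- the complex case
    (∀ (l : ℕ) (P Q : Matrix (Fin m) (Fin m) ℂ),
      FusionFrame.IsProjOfRank l P → FusionFrame.IsProjOfRank 1 Q →
      ∀ e : OrthonormalBasis (Fin m) ℂ (EuclideanSpace ℂ (Fin m)),
        FusionFrame.coherence₂ P =
            ((l : ℂ) - (l : ℂ) * ((l : ℂ) - 1) / ((m : ℂ) - 1)) • FusionFrame.coherence₂ Q +
              ((l : ℂ) * ((l : ℂ) - 1) / ((m : ℂ) * ((m : ℂ) - 1))) •
                ((1 : Matrix (Fin m) (Fin m) ℂ) ⊗ₖ (1 : Matrix (Fin m) (Fin m) ℂ)) ∧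
          FusionFrame.coherence₂ Q =
            FusionFrame.basisTensor e
              ((FusionFrame.coeffA m (FusionFrame.dComplex m) : ℝ) : ℂ)
              ((FusionFrame.coeffA m (FusionFrame.dComplex m) / 2 : ℝ) : ℂ)
              0) := by
  refine ⟨fun l P Q hP hQ e => ⟨?_, ?_⟩, fun l P Q hP hQ e => ⟨?_, ?_⟩⟩
  · exact FusionFrame.coherence₂_eq_rank_one hm hP hQ
  · exact FusionFrame.coherence₂_rank_one_real hm hQ e
  · exact FusionFrame.coherence₂_eq_rank_one hm hP hQ
  · exact FusionFrame.coherence₂_rank_one_complex hm hQ e
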